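/- Let $p\ge 2$, $m\ge 1$ be integers and let $\theta_1,\theta_2>1$, $\sigma_0>0$, $L\ge 3$, $\kappa_{\rm high}\ge 0$, $\kappa_p,\Delta,G_0,B_0\in\mathbb{R}$. There is a constant $C>0$, depending only on these quantities, such that the following holds for every $n$, every $f:\mathbb{R}^n\to\mathbb{R}$ and every $x_0\in\mathbb{R}^n$ with the properties below. Norms of vectors are Euclidean, norms of tensors are $\|T\|=\max_{\|s_1\|=\dots=\|s_p\|=1}|T[s_1,\dots,s_p]|$, and $\lambda_{\min}$ is the leftmost eigenvalue. **Assumptions.** 1. $f$ is $p$ times continuously differentiable. 2. $f\ge f_{\rm low}$ on $\mathbb{R}^n$, for some $f_{\rm low}\in\mathbb{R}$. 3. $\|\nabla^p f(x)-\nabla^p f(y)\|\le L\|x-y\|$ for all $x,y$. 4. $\min_{\|d\|\le 1}\nabla^i f(x)[d]^i\ge-\kappa_{\rm high}$ for all $x$ and all $i$ with $3\le i\le p-1$. 5. If $p\ge 3$, then $\|\nabla^p f(x)\|\le\kappa_p$ for all $x$. At the starting point, $f(x_0)-f_{\rm low}\le\Delta$, $\|\nabla f(x_0)\|\le G_0$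 and $-\lambda_{\min}(\nabla^2 f(x_0))\le B_0$. **Algorithm ARp-Lazy** (started at $x_0$, $\sigma_0$). For $k=0,1,2,\dots$: - set $T_k=\nabla^p f(x_k)$ if $m$ divides $k$, and $T_k=T_{k-1}$ otherwise; - with $\overline{T}_k(s)=f(x_k)+\sum_{i=1}^{p-1}\frac1{i!}\nabla^i f(x_k)[s]^i+\frac1{p!}T_k[s]^p$ and $m_k(s)=\overline{T}_k(s)+\frac{\sigma_k}{(p+1)!}\|s\|^{p+1}$, choose any step $s_k$ such that $$m_k(s_k)\le m_k(0),\qquad \|\nabla\overline{T}_k(s_k)\|\le\frac{\theta_1\sigma_k\|s_k\|^p}{p!},\qquad \max[0,-\lambda_{\min}(\nabla^2\overline{T}_k(s_k))]\le\frac{\theta_2\sigma_k\|s_k\|^{p-1}}{(p-1)!};$$ - set $x_{k+1}=x_k+s_k$ and $\sigma_{k+1}=\sigma_k+\sigma_k\|s_k\|^{p+1}$. Each iteration evaluates $\nabla^i f(x_k)$ for $1\le i\le p-1$, and also $\nabla^p f(x_k)$ if $m$ divides $k$. **Conclusion.** For every run of the algorithm and all $\epsilon_1,\epsilon_2>0$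 there is a $k\ge 0$ such that $$\|\nabla f(x_k)\|\le\epsilon_1\quad\text{and}\quad\lambda_{\min}(\nabla^2 f(x_k))\ge-\epsilon_2,$$ and both the number $k$ of iterations that produce $x_k$ and the total number of evaluations of the derivatives $\nabla^i f$, $1\le i\le p$, made in these $k$ iterations are at most $$C\,\max\left[\epsilon_1^{-(p+1)/p},\ \epsilon_2^{-(p+1)/(p-1)}\right].$$ -/

import Mathlib

open scoped Nat

noncomputable section

/-- The Hessian matrix of `F` at `x`, with entries `∇²F(x)[eᵢ, eⱼ]`. -/
def hessianMatrix {n : ℕ} (F : EuclideanSpace ℝ (Fin n) → ℝ) (x : EuclideanSpace ℝ (Fin n)) :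
    Matrix (Fin n) (Fin n) ℝ :=
  Matrix.of fun i j =>
    iteratedFDeriv ℝ 2 F x ![EuclideanSpace.single i 1, EuclideanSpace.single j 1]

/-- The leftmost eigenvalue of a real (symmetric) matrix. -/
def lambdaMin {n : ℕ} (A : Matrix (Fin n) (Fin n) ℝ) : ℝ :=
  sInf (spectrum ℝ A)

/-- The Taylor polynomial of order `p` of `f` at `x`, as a function of the displacement `s`,
with the `p`th derivative replaced by the tensor `T`. -/
def approxTaylor {n : ℕ} (p : ℕ) (f : EuclideanSpace ℝ (Fin n) → ℝ)
    (x : EuclideanSpace ℝ (Fin n))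
    (T : ContinuousMultilinearMap ℝ (fun _ : Fin p => EuclideanSpace ℝ (Fin n)) ℝ)
    (s : EuclideanSpace ℝ (Fin n)) : ℝ :=
  f x + ∑ i ∈ Finset.Icc 1 (p - 1), (1 / (i ! : ℝ)) * iteratedFDeriv ℝ i f x (fun _ => s)
    + (1 / (p ! : ℝ)) * T (fun _ => s)

/-- The regularized model `m(s)`. -/
def regModel {n : ℕ} (p : ℕ) (f : EuclideanSpace ℝ (Fin n) → ℝ)
    (x : EuclideanSpace ℝ (Fin n))
    (T : ContinuousMultilinearMap ℝ (fun _ : Fin p => EuclideanSpace ℝ (Fin n)) ℝ)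
    (σ : ℝ) (s : EuclideanSpace ℝ (Fin n)) : ℝ :=
  approxTaylor p f x T s + σ / ((p + 1)! : ℝ) * ‖s‖ ^ (p + 1)

/-- `(x, s, σ, T)` are the iterates, steps, regularization parameters and `p`th order tensors
of a run of ARp-Lazy on `f` from `x₀` with parameters `σ₀`, `θ₁`, `θ₂` and refresh period `m`.
Any steps that pass the three step tests are allowed. -/
structure IsARpLazyRun {n : ℕ} (p m : ℕ) (θ₁ θ₂ σ₀ : ℝ)
    (f : EuclideanSpace ℝ (Fin n) → ℝ) (x₀ : EuclideanSpace ℝ (Fin n))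
    (x s : ℕ → EuclideanSpace ℝ (Fin n)) (σ : ℕ → ℝ)
    (T : ℕ → ContinuousMultilinearMap ℝ (fun _ : Fin p => EuclideanSpace ℝ (Fin n)) ℝ) :
    Prop where
  x_zero : x 0 = x₀
  sigma_zero : σ 0 = σ₀
  /-- every `m` iterations the exact `p`th derivative is computed -/
  tensor_refresh : ∀ k, k % m = 0 → T k = iteratedFDeriv ℝ p f (x k)
  /-- in between the tensor is kept -/
  tensor_keep : ∀ k, (k + 1) % m ≠ 0 → T (k + 1) = T k
  model_decrease : ∀ k,
    regModel p f (x k) (T k) (σ k) (s k) - regModel p f (x k) (T k) (σ k) 0 ≤ 0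
  gradient_test : ∀ k,
    ‖gradient (approxTaylor p f (x k) (T k)) (s k)‖ ≤ θ₁ * σ k * ‖s k‖ ^ p / (p ! : ℝ)
  curvature_test : ∀ k,
    max 0 (-lambdaMin (hessianMatrix (approxTaylor p f (x k) (T k)) (s k))) ≤
      θ₂ * σ k * ‖s k‖ ^ (p - 1) / ((p - 1)! : ℝ)
  x_succ : ∀ k, x (k + 1) = x k + s k
  sigma_succ : ∀ k, σ (k + 1) = σ k + σ k * ‖s k‖ ^ (p + 1)

/-- The derivative evaluations made by ARp-Lazy in iterations `0, …, K - 1`: the pair `(i, j)`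
stands for the evaluation of `∇ⁱf` at `xⱼ` in iteration `j`. Derivatives of orders
`1, …, p - 1` are evaluated in every iteration, the `p`th one only when `m` divides `j`. -/
def lazyEvaluations (p m K : ℕ) : Finset (ℕ × ℕ) :=
  (Finset.Icc 1 p ×ˢ Finset.range K).filter fun c => c.1 < p ∨ c.2 % m = 0

end


/-! Freezing the tensor for at most `m` iterations and the Lipschitz continuity of `∇^p f` make the
error of the `k`th model in the `i`th derivative at `x_{k+1}` at most `L w_k^(p+1-i)`, where `w_k`
is the sum of the lengths of the last `m` steps. Hence the decrease of `f`, the gradient and the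
curvature at `x_{k+1}` are all controlled by `w_k`. The increment `σ_k ‖s_k‖^(p+1)` of `σ` is, up
to a constant, the guaranteed model decrease. The model errors, summed over all iterations, amount
to a multiple of `∑ ‖s_k‖^(p+1)`, which is dominated by that decrease once `σ_k` exceeds a
threshold `τ`. While `σ_k ≤ τ`, the steps are bounded because the derivatives at `x_k` are. So
`σ_k` never exceeds some `S`, and `∑ ‖s_k‖^(p+1) ≤ S / σ₀`. Every iterate `x_{k+1}` that misses one
of the two tolerances forces `w_k^(p+1)` to be at least a constant times the smaller of
`ε₁^((p+1)/p)` and `ε₂^((p+1)/(p-1))`, and each step belongs to at most `m` windows. -/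

section

open Finset

section Window

variable {a : ℕ → ℝ} {m p k : ℕ}

/-- The sum of the last `m` terms `a k, a (k - 1), …` of a sequence, fewer if `k + 1 < m`. -/
def windowSum (m : ℕ) (a : ℕ → ℝ) (k : ℕ) : ℝ :=
  ∑ i ∈ Ico (k + 1 - m) (k + 1), a i

theorem le_windowSum (ha : ∀ k, 0 ≤ a k) (hm : 1 ≤ m) (k : ℕ) : a k ≤ windowSum m a k :=
  single_le_sum (fun i _ => ha i) (by rw [mem_Ico]; lia)

theorem windowSum_nonneg (ha : ∀ k, 0 ≤ a k) (m k : ℕ) : 0 ≤ windowSum m a k :=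
  sum_nonneg fun i _ => ha i

theorem sum_Ico_le_mul {r : ℝ} (hr : 0 ≤ r) {u v : ℕ} (huv : v ≤ u + m)
    (h : ∀ i < v, a i ≤ r) : ∑ i ∈ Ico u v, a i ≤ m * r := by
  calc ∑ i ∈ Ico u v, a i ≤ #(Ico u v) • r :=
        sum_le_card_nsmul _ _ _ fun i hi => h i (mem_Ico.1 hi).2
    _ = ((v - u : ℕ) : ℝ) * r := by rw [nsmul_eq_mul, Nat.card_Ico]
    _ ≤ m * r := by gcongr; lia

theorem sum_windowSum_le (ha : ∀ k, 0 ≤ a k) (m K : ℕ) :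
    ∑ k ∈ range K, windowSum m a k ≤ m * ∑ i ∈ range K, a i := by
  have hcomm : ∑ k ∈ range K, windowSum m a k
      = ∑ i ∈ range K, ∑ _k ∈ Ico i (min K (i + m)), a i := by
    refine sum_comm' fun k i => ?_
    simp only [mem_range, mem_Ico]
    lia
  rw [hcomm, mul_sum]
  refine sum_le_sum fun i _ => ?_
  rw [sum_const, nsmul_eq_mul, Nat.card_Ico]
  gcongr
  · exact ha i
  · lia

theorem windowSum_pow_le (ha : ∀ k, 0 ≤ a k) (m p k : ℕ) :
    windowSum m a k ^ (p + 1) ≤ m ^ p * windowSum m (fun i => a i ^ (p + 1)) k := by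
  refine (pow_sum_le_card_mul_sum_pow (fun i _ => ha i) p).trans ?_
  rw [Nat.card_Ico, windowSum]
  gcongr
  · exact sum_nonneg fun i _ => pow_nonneg (ha i) _
  · lia

theorem sum_windowSum_pow_le (ha : ∀ k, 0 ≤ a k) (m p K : ℕ) :
    ∑ k ∈ range K, windowSum m a k ^ (p + 1)
      ≤ (m : ℝ) ^ (p + 1) * ∑ k ∈ range K, a k ^ (p + 1) := by
  calc ∑ k ∈ range K, windowSum m a k ^ (p + 1)
      ≤ ∑ k ∈ range K, (m : ℝ) ^ p * windowSum m (fun i => a i ^ (p + 1)) k :=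
        sum_le_sum fun k _ => windowSum_pow_le ha m p k
    _ ≤ (m : ℝ) ^ p * (m * ∑ k ∈ range K, a k ^ (p + 1)) := by
        rw [← mul_sum]
        gcongr
        exact sum_windowSum_le (fun i => pow_nonneg (ha i) _) m K
    _ = (m : ℝ) ^ (p + 1) * ∑ k ∈ range K, a k ^ (p + 1) := by ring

end Window

section Rate

theorem one_le_mul_rpow_mul_pow {c ε w : ℝ} (hc : 1 ≤ c) (hε : 0 < ε) (hw : 0 ≤ w)
    {r t d : ℕ} (hr : 0 < r) (htr : t ≤ d * r) (h : ε ≤ c * w ^ r) :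
    1 ≤ c ^ d * ε ^ (-((t : ℝ) / r)) * w ^ t := by
  have hr' : (0 : ℝ) < r := by exact_mod_cast hr
  have hq : (t : ℝ) / r ≤ d := by
    rw [div_le_iff₀ hr']
    exact_mod_cast htr
  have hpow : ε ^ ((t : ℝ) / r) ≤ c ^ d * w ^ t := by
    calc ε ^ ((t : ℝ) / r) ≤ (c * w ^ r) ^ ((t : ℝ) / r) := by gcongr
      _ = c ^ ((t : ℝ) / r) * w ^ t := by
        rw [Real.mul_rpow (by positivity) (by positivity), ← Real.rpow_natCast w r,
          ← Real.rpow_mul hw, mul_div_cancel₀ _ hr'.ne', Real.rpow_natCast]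
      _ ≤ c ^ (d : ℝ) * w ^ t := by gcongr
      _ = c ^ d * w ^ t := by rw [Real.rpow_natCast]
  rw [Real.rpow_neg hε.le, mul_right_comm, ← div_eq_mul_inv]
  exact (one_le_div (Real.rpow_pos_of_pos hε _)).2 hpow

/-- The complexity `max(ε₁^(-(p+1)/p), ε₂^(-(p+1)/(p-1)))` of finding points with gradient at most
`ε₁` and curvature at least `-ε₂` with `p`th order models. -/
noncomputable def complexityRate (p : ℕ) (ε₁ ε₂ : ℝ) : ℝ :=
  max (ε₁ ^ (-(((p : ℝ) + 1) / p))) (ε₂ ^ (-(((p : ℝ) + 1) / ((p : ℝ) - 1))))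

theorem complexityRate_pos {ε₁ : ℝ} (hε₁ : 0 < ε₁) (p : ℕ) (ε₂ : ℝ) :
    0 < complexityRate p ε₁ ε₂ :=
  lt_max_of_lt_left (Real.rpow_pos_of_pos hε₁ _)

theorem one_le_mul_complexityRate_mul_pow {p : ℕ} (hp : 2 ≤ p) {c ε₁ ε₂ w : ℝ} (hc : 1 ≤ c)
    (hε₁ : 0 < ε₁) (hε₂ : 0 < ε₂) (hw : 0 ≤ w) (h : ε₁ ≤ c * w ^ p ∨ ε₂ ≤ c * w ^ (p - 1)) :
    1 ≤ c ^ 3 * complexityRate p ε₁ ε₂ * w ^ (p + 1) := by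
  rcases h with h | h
  · refine (one_le_mul_rpow_mul_pow hc hε₁ hw (t := p + 1) (d := 3) (by lia) (by lia) h).trans ?_
    gcongr
    push_cast
    exact le_max_left _ _
  · refine (one_le_mul_rpow_mul_pow hc hε₂ hw (t := p + 1) (d := 3) (by lia) (by lia) h).trans ?_
    gcongr
    rw [Nat.cast_sub (by lia)]
    push_cast
    exact le_max_right _ _

end Rate

theorem le_max_of_mul_pow_le_sum_pow {a α A : ℝ} {p : ℕ} (hα : 0 < α) (hA : 0 ≤ A)
    (h : α * a ^ (p + 1) ≤ A * ∑ i ∈ Icc 1 p, a ^ i) : a ≤ max 1 (A * p / α) := by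
  rcases le_total a 1 with ha | ha
  · exact le_max_of_le_left ha
  · refine le_max_of_le_right ((le_div_iff₀ hα).2 ?_)
    have hsum : ∑ i ∈ Icc 1 p, a ^ i ≤ p * a ^ p := by
      simpa using sum_le_card_nsmul (Icc 1 p) (a ^ ·) (a ^ p)
        fun i hi => pow_le_pow_right₀ ha (mem_Icc.1 hi).2
    refine le_of_mul_le_mul_right (a := a ^ p) ?_ (by positivity)
    calc a * α * a ^ p = α * a ^ (p + 1) := by ring
      _ ≤ A * (p * a ^ p) := h.trans (by gcongr)
      _ = A * p * a ^ p := by ring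

/-- The scalar recurrences satisfied by a lazy regularization method of order `p` that refreshes
its tensor every `m` iterations: `a k` is the length of the `k`th step, `σ k` the regularization
parameter, `F k` the gap between the objective and its lower bound, `G k` the norm of the gradient
and `B k` the negative part of the leftmost Hessian eigenvalue. The error terms are window sums
because the tensor is outdated by at most `m - 1` steps. The number `η` is the coefficient of the
regularization term, `c` bounds the error coefficients and `M` the initial values. -/
structure IsLazyDescent (p m : ℕ) (η c M σ₀ : ℝ) (a σ F G B : ℕ → ℝ) : Prop where
  period_pos : 1 ≤ m
  eta_pos : 0 < η
  coeff_pos : 0 < c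
  sigma_init_pos : 0 < σ₀
  step_nonneg : ∀ k, 0 ≤ a k
  value_nonneg : ∀ k, 0 ≤ F k
  value_zero_le : F 0 ≤ M
  grad_zero_le : G 0 ≤ M
  curv_zero_le : B 0 ≤ M
  sigma_zero : σ 0 = σ₀
  sigma_succ : ∀ k, σ (k + 1) = σ k + σ k * a k ^ (p + 1)
  value_succ_le : ∀ k,
    F (k + 1) ≤ F k - η * (σ k * a k ^ (p + 1)) + c * windowSum m a k ^ (p + 1)
  grad_succ_le : ∀ k, G (k + 1) ≤ c * (σ k + 1) * windowSum m a k ^ p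
  curv_succ_le : ∀ k, B (k + 1) ≤ c * (σ k + 1) * windowSum m a k ^ (p - 1)
  step_bound : ∀ k, η * (σ k * a k ^ (p + 1)) ≤
    (G k + B k + M + c * ∑ i ∈ Ico (k + 1 - m) k, a i) * ∑ i ∈ Icc 1 p, a k ^ i

namespace IsLazyDescent

variable {p m : ℕ} {η c M σ₀ τ : ℝ} {a σ F G B : ℕ → ℝ} {k : ℕ}

theorem bound_nonneg (h : IsLazyDescent p m η c M σ₀ a σ F G B) : 0 ≤ M :=
  (h.value_nonneg 0).trans h.value_zero_le

theorem sigma_init_le (h : IsLazyDescent p m η c M σ₀ a σ F G B) (k : ℕ) : σ₀ ≤ σ k := by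
  induction k with
  | zero => exact h.sigma_zero.ge
  | succ k ih =>
    rw [h.sigma_succ]
    have := mul_nonneg (h.sigma_init_pos.le.trans ih) (pow_nonneg (h.step_nonneg k) (p + 1))
    linarith

theorem sigma_pos (h : IsLazyDescent p m η c M σ₀ a σ F G B) (k : ℕ) : 0 < σ k :=
  h.sigma_init_pos.trans_le (h.sigma_init_le k)

theorem sigma_monotone (h : IsLazyDescent p m η c M σ₀ a σ F G B) : Monotone σ :=
  monotone_nat_of_le_succ fun k => by
    rw [h.sigma_succ]
    have := mul_nonneg (h.sigma_pos k).le (pow_nonneg (h.step_nonneg k) (p + 1))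
    linarith

theorem mul_sum_step_pow_le (h : IsLazyDescent p m η c M σ₀ a σ F G B) (K : ℕ) :
    σ₀ * ∑ k ∈ range K, a k ^ (p + 1) ≤ σ K - σ₀ := by
  calc σ₀ * ∑ k ∈ range K, a k ^ (p + 1) ≤ ∑ k ∈ range K, (σ (k + 1) - σ k) := by
        rw [mul_sum]
        refine sum_le_sum fun k _ => ?_
        rw [h.sigma_succ, add_sub_cancel_left]
        exact mul_le_mul_of_nonneg_right (h.sigma_init_le k) (pow_nonneg (h.step_nonneg k) _)
    _ = σ K - σ₀ := by rw [sum_range_sub, h.sigma_zero]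

theorem sum_step_pow_le_sigma_div (h : IsLazyDescent p m η c M σ₀ a σ F G B) (K : ℕ) :
    ∑ k ∈ range K, a k ^ (p + 1) ≤ σ K / σ₀ := by
  rw [le_div_iff₀' h.sigma_init_pos]
  linarith [h.mul_sum_step_pow_le K, h.sigma_init_pos]

theorem value_le (h : IsLazyDescent p m η c M σ₀ a σ F G B) (K : ℕ) :
    F K ≤ F 0 - η * (σ K - σ₀) + c * ∑ k ∈ range K, windowSum m a k ^ (p + 1) := by
  induction K with
  | zero => simp [h.sigma_zero]
  | succ K ih =>
    rw [sum_range_succ, h.sigma_succ]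
    linarith [h.value_succ_le K]

theorem mul_sigma_le (h : IsLazyDescent p m η c M σ₀ a σ F G B) (K : ℕ) :
    η * σ K ≤ M + η * σ₀ + c * m ^ (p + 1) * ∑ k ∈ range K, a k ^ (p + 1) := by
  have hwin := mul_le_mul_of_nonneg_left (sum_windowSum_pow_le h.step_nonneg m p K) h.coeff_pos.le
  linarith [h.value_le K, h.value_nonneg K, h.value_zero_le]

theorem step_le_of_sigma_le (h : IsLazyDescent p m η c M σ₀ a σ F G B) (hk : σ k ≤ τ)
    {i : ℕ} (hi : i < k) : a i ≤ max 1 (τ / σ₀) := by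
  have hpow : a i ^ (p + 1) ≤ τ / σ₀ := by
    rw [le_div_iff₀' h.sigma_init_pos]
    have hmono := h.sigma_monotone hi
    have hmul := mul_le_mul_of_nonneg_right (h.sigma_init_le i)
      (pow_nonneg (h.step_nonneg i) (p + 1))
    linarith [h.sigma_succ i, h.sigma_pos i]
  rcases le_total (a i) 1 with ha | ha
  · exact le_max_of_le_left ha
  · exact le_max_of_le_right ((le_self_pow₀ ha p.succ_ne_zero).trans hpow)

theorem le_max_of_succ_le_mul_windowSum_pow (h : IsLazyDescent p m η c M σ₀ a σ F G B)
    (hk : σ k ≤ τ) {u : ℕ → ℝ} {q : ℕ} (hq : q ≤ p) (hu₀ : u 0 ≤ M)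
    (hu : ∀ k, u (k + 1) ≤ c * (σ k + 1) * windowSum m a k ^ q) :
    u k ≤ max M (c * (τ + 1) * (m * max 1 (τ / σ₀)) ^ p) := by
  rcases k with _ | j
  · exact le_max_of_le_left hu₀
  · refine le_max_of_le_right ((hu j).trans ?_)
    have hc := h.coeff_pos
    have hσ := h.sigma_pos j
    have hm : (1 : ℝ) ≤ m := by exact_mod_cast h.period_pos
    have hone : (1 : ℝ) ≤ m * max 1 (τ / σ₀) := one_le_mul_of_one_le_of_one_le hm (le_max_left _ _)
    have hw : windowSum m a j ≤ m * max 1 (τ / σ₀) :=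
      sum_Ico_le_mul (by positivity) (by lia) fun i hi => h.step_le_of_sigma_le hk hi
    have hσj : σ j ≤ τ := (h.sigma_monotone j.le_succ).trans hk
    have hpow : windowSum m a j ^ q ≤ (m * max 1 (τ / σ₀)) ^ p :=
      (pow_le_pow_left₀ (windowSum_nonneg h.step_nonneg m j) hw q).trans
        (pow_le_pow_right₀ hone hq)
    have hτ : 0 < τ := hσ.trans_le hσj
    have hw₀ := windowSum_nonneg h.step_nonneg m j
    gcongr

variable (p m η c M σ₀) in
theorem exists_step_bound (τ : ℝ) :
    ∃ R, 0 ≤ R ∧ ∀ {a σ F G B : ℕ → ℝ}, IsLazyDescent p m η c M σ₀ a σ F G B →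
      ∀ k, σ k ≤ τ → a k ≤ R := by
  set r := m * max 1 (τ / σ₀)
  set g := max M (c * (τ + 1) * r ^ p)
  refine ⟨max 1 ((g + g + M + c * r) * p / (η * σ₀)),
    zero_le_one.trans (le_max_left _ _), fun {a σ F G B} h k hk => ?_⟩
  have hc := h.coeff_pos
  have hM := h.bound_nonneg
  have hG : G k ≤ g :=
    h.le_max_of_succ_le_mul_windowSum_pow hk le_rfl h.grad_zero_le h.grad_succ_le
  have hB : B k ≤ g :=
    h.le_max_of_succ_le_mul_windowSum_pow hk (p.sub_le 1) h.curv_zero_le h.curv_succ_le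
  have hw : ∑ i ∈ Ico (k + 1 - m) k, a i ≤ r :=
    sum_Ico_le_mul (by positivity) (by lia) fun i hi => h.step_le_of_sigma_le hk hi
  have : 0 ≤ g := le_max_of_le_left hM
  have ha := pow_nonneg (h.step_nonneg k)
  refine le_max_of_mul_pow_le_sum_pow (mul_pos h.eta_pos h.sigma_init_pos) (by positivity) ?_
  calc η * σ₀ * a k ^ (p + 1) ≤ η * (σ k * a k ^ (p + 1)) := by
        rw [mul_assoc]
        exact mul_le_mul_of_nonneg_left
          (mul_le_mul_of_nonneg_right (h.sigma_init_le k) (ha _)) h.eta_pos.le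
    _ ≤ (G k + B k + M + c * ∑ i ∈ Ico (k + 1 - m) k, a i) * ∑ i ∈ Icc 1 p, a k ^ i :=
        h.step_bound k
    _ ≤ (g + g + M + c * r) * ∑ i ∈ Icc 1 p, a k ^ i := by
        have hsum := sum_nonneg fun i (_ : i ∈ Icc 1 p) => ha i
        gcongr

variable (p m η c M σ₀) in
/-- While `σ ≤ τ` the sum is at most `σ / σ₀`; afterwards each term is at most the increment of `σ`
divided by `τ`. -/
theorem exists_sum_step_pow_le (hτ : 0 < τ) :
    ∃ A, ∀ {a σ F G B : ℕ → ℝ}, IsLazyDescent p m η c M σ₀ a σ F G B →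
      ∀ K, ∑ k ∈ range K, a k ^ (p + 1) ≤ A + σ K / τ := by
  obtain ⟨R, hR₀, hR⟩ := exists_step_bound p m η c M σ₀ τ
  refine ⟨(τ + τ * R ^ (p + 1)) / σ₀, fun {a σ F G B} h K => ?_⟩
  have hσ₀ := h.sigma_init_pos
  induction K with
  | zero =>
    have := h.sigma_pos 0
    simp only [range_zero, sum_empty]
    positivity
  | succ K ih =>
    have ha := pow_nonneg (h.step_nonneg K) (p + 1)
    have hσ := h.sigma_pos (K + 1)
    rcases le_total (σ K) τ with hK | hK
    · have hsum := h.sum_step_pow_le_sigma_div (K + 1)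
      have hnext : σ (K + 1) ≤ τ + τ * R ^ (p + 1) := by
        rw [h.sigma_succ]
        gcongr
        · exact h.step_nonneg K
        · exact hR h K hK
      have hdiv : σ (K + 1) / σ₀ ≤ (τ + τ * R ^ (p + 1)) / σ₀ := by gcongr
      linarith [div_pos hσ hτ]
    · have hterm : a K ^ (p + 1) ≤ σ K * a K ^ (p + 1) / τ := by
        rw [le_div_iff₀' hτ]
        gcongr
      rw [sum_range_succ, h.sigma_succ, add_div (σ K)]
      linarith

variable (p m η c M σ₀) in
theorem exists_sigma_bound :
    ∃ S, ∀ {a σ F G B : ℕ → ℝ}, IsLazyDescent p m η c M σ₀ a σ F G B → ∀ k, σ k ≤ S := by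
  set b := c * (m : ℝ) ^ (p + 1)
  set τ := max 1 (2 * b / η)
  have hτ : 0 < τ := zero_lt_one.trans_le (le_max_left _ _)
  obtain ⟨A, hA⟩ := exists_sum_step_pow_le p m η c M σ₀ hτ
  refine ⟨2 * (M + η * σ₀ + b * A) / η, fun {a σ F G B} h k => ?_⟩
  have hη := h.eta_pos
  have hb : 0 ≤ b := mul_nonneg h.coeff_pos.le (by positivity)
  have hhalf : b * (σ k / τ) ≤ η * σ k / 2 := by
    have hbτ : 2 * b ≤ τ * η := (div_le_iff₀ hη).1 (le_max_right _ _)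
    rw [← mul_div_assoc, div_le_div_iff₀ hτ two_pos]
    linarith [mul_le_mul_of_nonneg_right hbτ (h.sigma_pos k).le]
  have hsum := mul_le_mul_of_nonneg_left (hA h k) hb
  rw [le_div_iff₀' hη]
  linarith [h.mul_sigma_le k]

theorem one_le_mul_complexityRate_mul_windowSum_pow (hp : 2 ≤ p) {S ε₁ ε₂ : ℝ} (hε₁ : 0 < ε₁)
    (hε₂ : 0 < ε₂) (h : IsLazyDescent p m η c M σ₀ a σ F G B) (hS : σ k ≤ S)
    (hk : ε₁ < G (k + 1) ∨ ε₂ < B (k + 1)) :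
    1 ≤ (max 1 (c * (S + 1))) ^ 3 * complexityRate p ε₁ ε₂ * windowSum m a k ^ (p + 1) := by
  have hw := windowSum_nonneg h.step_nonneg m k
  have hc : c * (σ k + 1) ≤ max 1 (c * (S + 1)) :=
    le_max_of_le_right (mul_le_mul_of_nonneg_left (by linarith) h.coeff_pos.le)
  refine one_le_mul_complexityRate_mul_pow hp (le_max_left _ _) hε₁ hε₂ hw
    (hk.imp (fun hG => hG.le.trans ?_) (fun hB => hB.le.trans ?_))
  · exact (h.grad_succ_le k).trans (by gcongr)
  · exact (h.curv_succ_le k).trans (by gcongr)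

theorem add_one_le_mul_complexityRate (hp : 2 ≤ p) {S ε₁ ε₂ : ℝ} (hε₁ : 0 < ε₁) (hε₂ : 0 < ε₂)
    (h : IsLazyDescent p m η c M σ₀ a σ F G B) (hS : ∀ k, σ k ≤ S) {K : ℕ}
    (hK : ∀ k ≤ K, ε₁ < G k ∨ ε₂ < B k) :
    (K : ℝ) + 1 ≤ ((max 1 (c * (S + 1))) ^ 3 * (m ^ (p + 1) * (S / σ₀)) + (max 1 M) ^ 3)
      * complexityRate p ε₁ ε₂ := by
  set D := max 1 (c * (S + 1))
  set E := complexityRate p ε₁ ε₂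
  have hE : 0 < E := complexityRate_pos hε₁ p ε₂
  have hstart : 1 ≤ (max 1 M) ^ 3 * E := by
    have := one_le_mul_complexityRate_mul_pow hp (le_max_left 1 M) hε₁ hε₂ zero_le_one
      ((hK 0 K.zero_le).imp
        (fun hG => by simpa using Or.inr (hG.le.trans h.grad_zero_le))
        (fun hB => by simpa using Or.inr (hB.le.trans h.curv_zero_le)))
    simpa using this
  have hwindow : ∀ k ∈ range K, 1 ≤ D ^ 3 * E * windowSum m a k ^ (p + 1) := fun k hk =>
    h.one_le_mul_complexityRate_mul_windowSum_pow hp hε₁ hε₂ (hS k) (hK (k + 1) (mem_range.1 hk))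
  have hsum : ∑ k ∈ range K, windowSum m a k ^ (p + 1) ≤ m ^ (p + 1) * (S / σ₀) := by
    have := h.sigma_init_pos
    refine (sum_windowSum_pow_le h.step_nonneg m p K).trans ?_
    gcongr
    exact (h.sum_step_pow_le_sigma_div K).trans (by gcongr; exact hS K)
  have hcount : (K : ℝ) ≤ D ^ 3 * E * ∑ k ∈ range K, windowSum m a k ^ (p + 1) := by
    simpa [mul_sum] using card_nsmul_le_sum (range K) _ _ hwindow
  have := mul_le_mul_of_nonneg_left hsum (by positivity : 0 ≤ D ^ 3 * E)
  linarith

variable (p m η c M σ₀) in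
theorem exists_iteration_bound (hp : 2 ≤ p) :
    ∃ C, 0 < C ∧ ∀ {a σ F G B : ℕ → ℝ}, IsLazyDescent p m η c M σ₀ a σ F G B →
      ∀ ε₁ ε₂ : ℝ, 0 < ε₁ → 0 < ε₂ →
        ∃ k : ℕ, G k ≤ ε₁ ∧ B k ≤ ε₂ ∧ (k : ℝ) ≤ C * complexityRate p ε₁ ε₂ := by
  obtain ⟨S, hS⟩ := exists_sigma_bound p m η c M σ₀
  set C := (max 1 (c * (S + 1))) ^ 3 * (m ^ (p + 1) * (S / σ₀)) + (max 1 M) ^ 3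
  refine ⟨max 1 C, by positivity, fun {a σ F G B} h ε₁ ε₂ hε₁ hε₂ => ?_⟩
  have hrate := complexityRate_pos hε₁ p ε₂
  set K := ⌊max 1 C * complexityRate p ε₁ ε₂⌋₊
  by_contra! hfail
  have hK : (K : ℝ) ≤ max 1 C * complexityRate p ε₁ ε₂ := Nat.floor_le (by positivity)
  have hsucc : (K : ℝ) + 1 ≤ C * complexityRate p ε₁ ε₂ := by
    refine h.add_one_le_mul_complexityRate hp hε₁ hε₂ (hS h) fun k hk => ?_
    by_contra! hsmall
    have hkK : (k : ℝ) ≤ K := by exact_mod_cast hk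
    exact (hfail k hsmall.1 hsmall.2).not_ge (hkK.trans hK)
  have hmax := mul_le_mul_of_nonneg_right (le_max_right 1 C) hrate.le
  linarith [Nat.lt_floor_add_one (max 1 C * complexityRate p ε₁ ε₂)]

end IsLazyDescent

section IteratedDerivative

variable {𝕜 E F : Type*} [NontriviallyNormedField 𝕜] [NormedAddCommGroup E] [NormedSpace 𝕜 E]
  [NormedAddCommGroup F] [NormedSpace 𝕜 F] {n : ℕ} {f : E → F}

theorem fderiv_continuousMultilinearMap_apply
    {Φ : E → ContinuousMultilinearMap 𝕜 (fun _ : Fin n => E) F} {x : E}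
    (hΦ : DifferentiableAt 𝕜 Φ x) (u : Fin n → E) (z : E) :
    fderiv 𝕜 (fun y => Φ y u) x z = fderiv 𝕜 Φ x z u :=
  congrArg (fun l => l z) ((ContinuousMultilinearMap.apply 𝕜 (fun _ : Fin n => E) F
    u).hasFDerivAt.comp x hΦ.hasFDerivAt).fderiv

theorem iteratedFDeriv_succ_apply_eq_fderiv (hf : ContDiff 𝕜 (n + 1) f) (x : E)
    (v : Fin (n + 1) → E) :
    iteratedFDeriv 𝕜 (n + 1) f x v
      = fderiv 𝕜 (fun y => iteratedFDeriv 𝕜 n f y (Fin.tail v)) x (v 0) := by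
  have hd : Differentiable 𝕜 (iteratedFDeriv 𝕜 n f) :=
    hf.differentiable_iteratedFDeriv (by exact_mod_cast n.lt_succ_self)
  rw [iteratedFDeriv_succ_apply_left, fderiv_continuousMultilinearMap_apply (hd x)]

theorem iteratedFDeriv_add_two_apply (hf : ContDiff 𝕜 (n + 2) f) (x : E) (v : Fin (n + 2) → E) :
    iteratedFDeriv 𝕜 (n + 2) f x v
      = fderiv 𝕜 (fderiv 𝕜 (iteratedFDeriv 𝕜 n f)) x (v 0) (v 1) (Fin.tail (Fin.tail v)) := by
  have hd : DifferentiableAt 𝕜 (fderiv 𝕜 (iteratedFDeriv 𝕜 n f)) x :=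
    ((hf.iteratedFDeriv_right (m := 2) (by rw [add_comm])).fderiv_right (m := 1)
      (by norm_num)).differentiable (by norm_num) x
  rw [iteratedFDeriv_succ_apply_eq_fderiv (by exact_mod_cast hf)]
  simp only [iteratedFDeriv_succ_apply_left]
  rw [fderiv_continuousMultilinearMap_apply (hd.clm_apply (differentiableAt_const _)),
    fderiv_clm_apply hd (differentiableAt_const _)]
  simp [Fin.tail]

end IteratedDerivative

section Symmetry

variable {𝕜 E F : Type*} [RCLike 𝕜] [NormedAddCommGroup E] [NormedSpace 𝕜 E]
  [NormedAddCommGroup F] [NormedSpace 𝕜 F] {n : ℕ} {f : E → F}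

theorem iteratedFDeriv_comp_swap_zero_one (hf : ContDiff 𝕜 (n + 2) f) (x : E)
    (v : Fin (n + 2) → E) :
    iteratedFDeriv 𝕜 (n + 2) f x (v ∘ Equiv.swap 0 1) = iteratedFDeriv 𝕜 (n + 2) f x v := by
  have hsymm : IsSymmSndFDerivAt 𝕜 (iteratedFDeriv 𝕜 n f) x :=
    (hf.iteratedFDeriv_right (m := 2) (by rw [add_comm])).contDiffAt.isSymmSndFDerivAt (by simp)
  have htail : Fin.tail (Fin.tail (v ∘ Equiv.swap 0 1)) = Fin.tail (Fin.tail v) := by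
    funext i
    simp only [Fin.tail, Function.comp_apply]
    rw [Equiv.swap_apply_of_ne_of_ne (Fin.succ_ne_zero _) (by simp [Fin.ext_iff])]
  rw [iteratedFDeriv_add_two_apply hf, iteratedFDeriv_add_two_apply hf, htail]
  simpa using congrArg (fun l => l (Fin.tail (Fin.tail v))) (hsymm (v 1) (v 0))

theorem iteratedFDeriv_comp_swap_castSucc_succ (hf : ContDiff 𝕜 (n + 1) f) (i : Fin n) (x : E)
    (v : Fin (n + 1) → E) :
    iteratedFDeriv 𝕜 (n + 1) f x (v ∘ Equiv.swap i.castSucc i.succ)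
      = iteratedFDeriv 𝕜 (n + 1) f x v := by
  induction n generalizing x with
  | zero => exact i.elim0
  | succ n ih =>
    cases i using Fin.cases with
    | zero => exact iteratedFDeriv_comp_swap_zero_one (by exact_mod_cast hf) x v
    | succ j =>
      have htail : Fin.tail (v ∘ Equiv.swap j.succ.castSucc j.succ.succ)
          = Fin.tail v ∘ Equiv.swap j.castSucc j.succ := by
        funext l
        simp only [Fin.tail, Function.comp_apply]
        rw [← Fin.succ_castSucc, (Fin.succ_injective _).swap_apply]
      have hzero : Equiv.swap j.succ.castSucc j.succ.succ 0 = 0 :=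
        Equiv.swap_apply_of_ne_of_ne (by simp [Fin.ext_iff]) (Fin.succ_ne_zero _).symm
      rw [iteratedFDeriv_succ_apply_eq_fderiv hf, iteratedFDeriv_succ_apply_eq_fderiv hf, htail,
        Function.comp_apply, hzero]
      congr 2
      funext y
      exact ih (hf.of_le (by exact_mod_cast (n + 1).le_succ)) j y (Fin.tail v)

theorem iteratedFDeriv_comp_perm (hf : ContDiff 𝕜 n f) (x : E) (v : Fin n → E)
    (σ : Equiv.Perm (Fin n)) : iteratedFDeriv 𝕜 n f x (v ∘ σ) = iteratedFDeriv 𝕜 n f x v := by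
  rcases n with _ | n
  · rw [Subsingleton.elim σ 1, Equiv.Perm.coe_one, Function.comp_id]
  have hσ : σ ∈ Submonoid.closure
      (Set.range fun i : Fin n => Equiv.swap i.castSucc i.succ) := by
    rw [Equiv.Perm.mclosure_swap_castSucc_succ]
    exact Submonoid.mem_top σ
  induction hσ using Submonoid.closure_induction generalizing v with
  | mem _ h =>
    obtain ⟨i, rfl⟩ := h
    exact iteratedFDeriv_comp_swap_castSucc_succ (by exact_mod_cast hf) i x v
  | one => rw [Equiv.Perm.coe_one, Function.comp_id]
  | mul τ ρ _ _ hτ hρ => rw [Equiv.Perm.coe_mul, ← Function.comp_assoc, hρ, hτ]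

end Symmetry

section Taylor

theorem iteratedFDeriv_eq_zero_of_hasFiniteFPowerSeriesOnBall {𝕜 E F : Type*}
    [NontriviallyNormedField 𝕜] [NormedAddCommGroup E] [NormedSpace 𝕜 E] [NormedAddCommGroup F]
    [NormedSpace 𝕜 F] [CompleteSpace F] {f : E → F} {q : FormalMultilinearSeries 𝕜 E F} {x : E}
    {n : ℕ} (h : HasFiniteFPowerSeriesOnBall f q x n ⊤) (y : E) :
    iteratedFDeriv 𝕜 n f y = 0 := by
  have hy : HasFiniteFPowerSeriesOnBall f (q.changeOrigin (y - x)) y n ⊤ := by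
    simpa using h.changeOrigin (y := y - x) ENNReal.coe_lt_top
  ext v
  rw [hy.toHasFPowerSeriesOnBall.iteratedFDeriv_eq_sum_of_completeSpace, hy.finite n le_rfl]
  simp

theorem norm_iteratedFDeriv_le_mul_pow {E F : Type*} [NormedAddCommGroup E] [NormedSpace ℝ E]
    [NormedAddCommGroup F] [NormedSpace ℝ F] {g : E → F} {p : ℕ} (hg : ContDiff ℝ p g)
    (hzero : ∀ i < p, iteratedFDeriv ℝ i g 0 = 0) {M ρ : ℝ}
    (hM : ∀ y, ‖y‖ ≤ ρ → ‖iteratedFDeriv ℝ p g y‖ ≤ M) {i j : ℕ} (hij : i + j = p) {y : E}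
    (hy : ‖y‖ ≤ ρ) : ‖iteratedFDeriv ℝ i g y‖ ≤ M * ‖y‖ ^ j := by
  induction j generalizing i y with
  | zero =>
    obtain rfl : i = p := hij
    simpa using hM y hy
  | succ j ih =>
    have hM₀ : 0 ≤ M := (norm_nonneg _).trans (hM y hy)
    have hdiff : Differentiable ℝ (iteratedFDeriv ℝ i g) :=
      hg.differentiable_iteratedFDeriv (by exact_mod_cast (by lia : i < p))
    have hfderiv : ∀ z ∈ Metric.closedBall (0 : E) ‖y‖,
        ‖fderiv ℝ (iteratedFDeriv ℝ i g) z‖ ≤ M * ‖y‖ ^ j := by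
      intro z hz
      rw [mem_closedBall_zero_iff] at hz
      rw [norm_fderiv_iteratedFDeriv]
      exact (ih (by lia) (hz.trans hy)).trans (by gcongr)
    have hmean := (convex_closedBall (0 : E) ‖y‖).norm_image_sub_le_of_norm_fderiv_le
      (fun z _ => hdiff z) hfderiv (Metric.mem_closedBall_self (norm_nonneg y))
      (mem_closedBall_zero_iff.2 le_rfl)
    rwa [hzero i (by lia), sub_zero, sub_zero, mul_assoc, ← pow_succ] at hmean

end Taylor

section ApproxTaylor

variable {n p : ℕ} (f : EuclideanSpace ℝ (Fin n) → ℝ) (x : EuclideanSpace ℝ (Fin n))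
  (T : ContinuousMultilinearMap ℝ (fun _ : Fin p => EuclideanSpace ℝ (Fin n)) ℝ)

theorem approxTaylor_zero (hp : 1 ≤ p) : approxTaylor p f x T 0 = f x := by
  have hdiag : ∀ {i : ℕ}, 1 ≤ i → ∀ A : ContinuousMultilinearMap ℝ
      (fun _ : Fin i => EuclideanSpace ℝ (Fin n)) ℝ, A (fun _ => 0) = 0 :=
    fun hi A => A.map_coord_zero ⟨0, hi⟩ rfl
  rw [approxTaylor, hdiag hp, sum_eq_zero]
  · simp
  · intro i hi
    rw [hdiag (mem_Icc.1 hi).1, mul_zero]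

/-- The expansion of `approxTaylor p f x T` at the origin as a formal multilinear series; it makes
the library's results on power series available for the model. -/
noncomputable def approxTaylorSeries (p : ℕ) (f : EuclideanSpace ℝ (Fin n) → ℝ)
    (x : EuclideanSpace ℝ (Fin n))
    (T : ContinuousMultilinearMap ℝ (fun _ : Fin p => EuclideanSpace ℝ (Fin n)) ℝ) :
    FormalMultilinearSeries ℝ (EuclideanSpace ℝ (Fin n)) ℝ :=
  Function.update (fun i => if i < p then (1 / (i ! : ℝ)) • iteratedFDeriv ℝ i f x else 0) p
    ((1 / (p ! : ℝ)) • T)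

theorem approxTaylorSeries_self : approxTaylorSeries p f x T p = (1 / (p ! : ℝ)) • T := by
  simp [approxTaylorSeries]

theorem approxTaylorSeries_of_lt {i : ℕ} (hi : i < p) :
    approxTaylorSeries p f x T i = (1 / (i ! : ℝ)) • iteratedFDeriv ℝ i f x := by
  simp [approxTaylorSeries, hi.ne, hi]

theorem approxTaylorSeries_of_gt {i : ℕ} (hi : p < i) : approxTaylorSeries p f x T i = 0 := by
  simp [approxTaylorSeries, hi.ne', hi.not_gt]

theorem hasFiniteFPowerSeriesOnBall_approxTaylor (hp : 1 ≤ p) :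
    HasFiniteFPowerSeriesOnBall (approxTaylor p f x T) (approxTaylorSeries p f x T) 0
      (p + 1 : ℕ) ⊤ := by
  refine HasFiniteFPowerSeriesOnBall.mk' (fun i hi => approxTaylorSeries_of_gt f x T hi)
    (by simp) fun y _ => ?_
  have hIcc : Icc 1 (p - 1) = Ico (0 + 1) p := by
    ext i
    simp only [mem_Icc, mem_Ico]
    lia
  have hlow : ∑ i ∈ range p, approxTaylorSeries p f x T i (fun _ => y)
      = ∑ i ∈ range p, 1 / (i ! : ℝ) * iteratedFDeriv ℝ i f x (fun _ => y) :=
    sum_congr rfl fun i hi => by rw [approxTaylorSeries_of_lt f x T (mem_range.1 hi)]; rfl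
  rw [zero_add, sum_range_succ, hlow, approxTaylorSeries_self, approxTaylor, hIcc, range_eq_Ico,
    sum_eq_sum_Ico_succ_bot (zero_lt_one.trans_le hp)]
  simp

theorem contDiff_approxTaylor (hp : 1 ≤ p) {k : WithTop ℕ∞} :
    ContDiff ℝ k (approxTaylor p f x T) := by
  have hseries := (hasFiniteFPowerSeriesOnBall_approxTaylor f x T hp).toHasFPowerSeriesOnBall
  exact contDiff_iff_contDiffAt.2 fun y => (hseries.analyticOnNhd y (by simp)).contDiffAt

variable {f x T}

theorem iteratedFDeriv_approxTaylor_zero (hp : 1 ≤ p) {i : ℕ}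
    {A : ContinuousMultilinearMap ℝ (fun _ : Fin i => EuclideanSpace ℝ (Fin n)) ℝ}
    (hA : ∀ (v : Fin i → EuclideanSpace ℝ (Fin n)) (τ : Equiv.Perm (Fin i)), A (v ∘ τ) = A v)
    (hcoeff : approxTaylorSeries p f x T i = (1 / (i ! : ℝ)) • A) :
    iteratedFDeriv ℝ i (approxTaylor p f x T) 0 = A := by
  have hseries := (hasFiniteFPowerSeriesOnBall_approxTaylor f x T hp).toHasFPowerSeriesOnBall
  ext v
  have hterm : ∀ τ : Equiv.Perm (Fin i),
      approxTaylorSeries p f x T i (fun j => v (τ j)) = 1 / (i ! : ℝ) * A v := fun τ => by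
    rw [hcoeff, ← hA v τ]
    rfl
  rw [hseries.iteratedFDeriv_eq_sum_of_completeSpace v]
  simp only [hterm, sum_const, card_univ, Fintype.card_perm, Fintype.card_fin, nsmul_eq_mul]
  have := Nat.factorial_ne_zero i
  field_simp

theorem iteratedFDeriv_approxTaylor_self (hp : 1 ≤ p)
    (hT : ∀ (v : Fin p → EuclideanSpace ℝ (Fin n)) (τ : Equiv.Perm (Fin p)), T (v ∘ τ) = T v)
    (s : EuclideanSpace ℝ (Fin n)) : iteratedFDeriv ℝ p (approxTaylor p f x T) s = T := by
  have hdiff : Differentiable ℝ (iteratedFDeriv ℝ p (approxTaylor p f x T)) :=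
    (contDiff_approxTaylor f x T hp (k := ⊤)).differentiable_iteratedFDeriv (by simp)
  have hfderiv : ∀ y, ‖fderiv ℝ (iteratedFDeriv ℝ p (approxTaylor p f x T)) y‖ = 0 := fun y => by
    rw [norm_fderiv_iteratedFDeriv, iteratedFDeriv_eq_zero_of_hasFiniteFPowerSeriesOnBall
      (hasFiniteFPowerSeriesOnBall_approxTaylor f x T hp), norm_zero]
  rw [is_const_of_fderiv_eq_zero hdiff (fun y => norm_eq_zero.1 (hfderiv y)) s 0]
  exact iteratedFDeriv_approxTaylor_zero hp hT (approxTaylorSeries_self f x T)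

theorem norm_iteratedFDeriv_sub_approxTaylor_le (hp : 1 ≤ p) {L : ℝ} (hL : 0 ≤ L)
    (hf : ContDiff ℝ p f)
    (hlip : ∀ y z, ‖iteratedFDeriv ℝ p f y - iteratedFDeriv ℝ p f z‖ ≤ L * ‖y - z‖)
    (hT : ∀ (v : Fin p → EuclideanSpace ℝ (Fin n)) (τ : Equiv.Perm (Fin p)), T (v ∘ τ) = T v)
    (s : EuclideanSpace ℝ (Fin n)) {i j : ℕ} (hij : i + j = p) :
    ‖iteratedFDeriv ℝ i f (x + s) - iteratedFDeriv ℝ i (approxTaylor p f x T) s‖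
      ≤ (‖T - iteratedFDeriv ℝ p f x‖ + L * ‖s‖) * ‖s‖ ^ j := by
  have hmodel : ContDiff ℝ p (approxTaylor p f x T) := contDiff_approxTaylor f x T hp
  have hshift : ContDiff ℝ p (fun z => f (x + z)) := hf.comp (contDiff_const.add contDiff_id)
  have hle : ∀ {i : ℕ}, i ≤ p → (i : WithTop ℕ∞) ≤ p := fun hi => by exact_mod_cast hi
  have hsub : ∀ {i : ℕ}, i ≤ p → ∀ y,
      iteratedFDeriv ℝ i (fun z => f (x + z) - approxTaylor p f x T z) y
        = iteratedFDeriv ℝ i f (x + y) - iteratedFDeriv ℝ i (approxTaylor p f x T) y :=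
    fun hi y => by
      rw [fun_iteratedFDeriv_sub_apply (hshift.of_le (hle hi)).contDiffAt
        (hmodel.of_le (hle hi)).contDiffAt, iteratedFDeriv_comp_add_left']
  rw [← hsub (by lia)]
  refine norm_iteratedFDeriv_le_mul_pow (hshift.sub hmodel) (fun i hi => ?_) (fun y hy => ?_) hij
    le_rfl
  · rw [hsub hi.le, iteratedFDeriv_approxTaylor_zero hp
      (iteratedFDeriv_comp_perm (hf.of_le (hle hi.le)) x) (approxTaylorSeries_of_lt f x T hi),
      add_zero, sub_self]
  · rw [hsub le_rfl, iteratedFDeriv_approxTaylor_self hp hT]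
    calc ‖iteratedFDeriv ℝ p f (x + y) - T‖
        ≤ ‖iteratedFDeriv ℝ p f (x + y) - iteratedFDeriv ℝ p f x‖
          + ‖iteratedFDeriv ℝ p f x - T‖ := norm_sub_le_norm_sub_add_norm_sub _ _ _
      _ ≤ L * ‖y‖ + ‖T - iteratedFDeriv ℝ p f x‖ := by
          rw [norm_sub_rev _ T]
          gcongr
          simpa using hlip (x + y) x
      _ ≤ ‖T - iteratedFDeriv ℝ p f x‖ + L * ‖s‖ := by
          rw [add_comm]
          gcongr

end ApproxTaylor

section LeftmostEigenvalue

variable {n : ℕ}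

theorem lambdaMin_of_isEmpty (A : Matrix (Fin 0) (Fin 0) ℝ) : lambdaMin A = 0 := by
  simp [lambdaMin]

open scoped MatrixOrder in
theorem forall_mul_dotProduct_le_iff {A : Matrix (Fin n) (Fin n) ℝ} (hA : A.IsHermitian) (c : ℝ) :
    (∀ v : Fin n → ℝ, c * (v ⬝ᵥ v) ≤ v ⬝ᵥ A.mulVec v) ↔ ∀ a ∈ spectrum ℝ A, c ≤ a := by
  have hform : ∀ v : Fin n → ℝ, star v ⬝ᵥ (A - algebraMap ℝ _ c).mulVec v
      = v ⬝ᵥ A.mulVec v - c * (v ⬝ᵥ v) := fun v => by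
    rw [Matrix.sub_mulVec, dotProduct_sub, Algebra.algebraMap_eq_smul_one, Matrix.smul_mulVec,
      Matrix.one_mulVec, dotProduct_smul, star_trivial, smul_eq_mul]
  have hsub : (A - algebraMap ℝ (Matrix (Fin n) (Fin n) ℝ) c).IsHermitian := by
    rw [Matrix.algebraMap_eq_diagonal]
    exact hA.sub (Matrix.isHermitian_diagonal _)
  rw [← algebraMap_le_iff_le_spectrum (ha := hA.isSelfAdjoint), Matrix.le_iff,
    Matrix.posSemidef_iff_dotProduct_mulVec, and_iff_right hsub]
  simp only [hform, sub_nonneg]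

theorem lambdaMin_mul_le_dotProduct {A : Matrix (Fin n) (Fin n) ℝ} (hA : A.IsHermitian)
    (v : Fin n → ℝ) : lambdaMin A * (v ⬝ᵥ v) ≤ v ⬝ᵥ A.mulVec v := by
  have hbdd : BddBelow (spectrum ℝ A) := by
    rw [hA.spectrum_real_eq_range_eigenvalues]
    exact (Set.finite_range _).bddBelow
  exact (forall_mul_dotProduct_le_iff hA _).2 (fun a ha => csInf_le hbdd ha) v

theorem le_lambdaMin [NeZero n] {A : Matrix (Fin n) (Fin n) ℝ} (hA : A.IsHermitian) {c : ℝ}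
    (h : ∀ v : Fin n → ℝ, c * (v ⬝ᵥ v) ≤ v ⬝ᵥ A.mulVec v) : c ≤ lambdaMin A := by
  refine le_csInf ?_ ((forall_mul_dotProduct_le_iff hA c).1 h)
  rw [hA.spectrum_real_eq_range_eigenvalues]
  exact Set.range_nonempty _

theorem isHermitian_hessianMatrix {F : EuclideanSpace ℝ (Fin n) → ℝ} (hF : ContDiff ℝ 2 F)
    (x : EuclideanSpace ℝ (Fin n)) : (hessianMatrix F x).IsHermitian := by
  ext i j
  simp only [hessianMatrix, Matrix.conjTranspose_apply, Matrix.of_apply, star_trivial,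
    iteratedFDeriv_two_apply]
  exact hF.contDiffAt.isSymmSndFDerivAt (by simp) _ _

theorem dotProduct_hessianMatrix_mulVec (F : EuclideanSpace ℝ (Fin n) → ℝ)
    (x v : EuclideanSpace ℝ (Fin n)) :
    v.ofLp ⬝ᵥ (hessianMatrix F x).mulVec v.ofLp = iteratedFDeriv ℝ 2 F x (fun _ => v) := by
  have hv : v = ∑ i, v i • EuclideanSpace.single i (1 : ℝ) := by
    ext j
    simp [Finset.sum_apply, Pi.single_apply]
  conv_rhs => rw [iteratedFDeriv_two_apply, hv]
  simp only [map_sum, map_smul, _root_.sum_apply, smul_apply, dotProduct, Matrix.mulVec,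
    hessianMatrix, Matrix.of_apply, iteratedFDeriv_two_apply, smul_eq_mul, mul_sum,
    Matrix.cons_val_zero, Matrix.cons_val_one]
  rw [sum_comm]
  exact sum_congr rfl fun i _ => sum_congr rfl fun j _ => by ring

theorem dotProduct_self_eq_norm_sq (v : EuclideanSpace ℝ (Fin n)) :
    v.ofLp ⬝ᵥ v.ofLp = ‖v‖ ^ 2 := by
  rw [EuclideanSpace.real_norm_sq_eq, dotProduct]
  exact sum_congr rfl fun i _ => (sq _).symm

theorem lambdaMin_hessianMatrix_mul_le {F : EuclideanSpace ℝ (Fin n) → ℝ} (hF : ContDiff ℝ 2 F)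
    (x v : EuclideanSpace ℝ (Fin n)) :
    lambdaMin (hessianMatrix F x) * ‖v‖ ^ 2 ≤ iteratedFDeriv ℝ 2 F x (fun _ => v) := by
  rw [← dotProduct_hessianMatrix_mulVec, ← dotProduct_self_eq_norm_sq]
  exact lambdaMin_mul_le_dotProduct (isHermitian_hessianMatrix hF x) _

theorem lambdaMin_hessianMatrix_sub_le {F P : EuclideanSpace ℝ (Fin n) → ℝ} (hF : ContDiff ℝ 2 F)
    (hP : ContDiff ℝ 2 P) (x y : EuclideanSpace ℝ (Fin n)) :
    lambdaMin (hessianMatrix P y) - ‖iteratedFDeriv ℝ 2 F x - iteratedFDeriv ℝ 2 P y‖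
      ≤ lambdaMin (hessianMatrix F x) := by
  rcases n.eq_zero_or_pos with rfl | hn
  · simp [lambdaMin_of_isEmpty]
  have : NeZero n := ⟨hn.ne'⟩
  refine le_lambdaMin (isHermitian_hessianMatrix hF x) fun w => ?_
  obtain ⟨v, rfl⟩ := (WithLp.equiv 2 (Fin n → ℝ)).surjective w
  have hdiff := (iteratedFDeriv ℝ 2 F x - iteratedFDeriv ℝ 2 P y).le_opNorm fun _ => v
  rw [Real.norm_eq_abs, Fin.prod_const, abs_le, sub_apply] at hdiff
  rw [WithLp.equiv_apply, dotProduct_hessianMatrix_mulVec, dotProduct_self_eq_norm_sq, sub_mul]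
  linarith [lambdaMin_hessianMatrix_mul_le hP y v, hdiff.1]

end LeftmostEigenvalue

section ModelComparison

theorem norm_gradient_le_add {E : Type*} [NormedAddCommGroup E] [InnerProductSpace ℝ E]
    [CompleteSpace E] (F P : E → ℝ) (x y : E) :
    ‖gradient F x‖ ≤ ‖gradient P y‖ + ‖iteratedFDeriv ℝ 1 F x - iteratedFDeriv ℝ 1 P y‖ := by
  have hdiff : ‖gradient F x - gradient P y‖
      ≤ ‖iteratedFDeriv ℝ 1 F x - iteratedFDeriv ℝ 1 P y‖ := by
    rw [gradient, gradient, ← map_sub, LinearIsometryEquiv.norm_map]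
    refine ContinuousLinearMap.opNorm_le_bound _ (norm_nonneg _) fun v => ?_
    simpa using (iteratedFDeriv ℝ 1 F x - iteratedFDeriv ℝ 1 P y).le_opNorm fun _ => v
  exact (norm_le_norm_add_norm_sub' _ _).trans (by gcongr)

theorem le_add_norm_iteratedFDeriv_zero_sub {E : Type*} [NormedAddCommGroup E] [NormedSpace ℝ E]
    (F P : E → ℝ) (x y : E) :
    F x ≤ P y + ‖iteratedFDeriv ℝ 0 F x - iteratedFDeriv ℝ 0 P y‖ := by
  have hdiff := (iteratedFDeriv ℝ 0 F x - iteratedFDeriv ℝ 0 P y).le_opNorm 0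
  simp only [sub_apply, iteratedFDeriv_zero_apply, univ_eq_empty, prod_empty, mul_one] at hdiff
  linarith [Real.le_norm_self (F x - P y)]

theorem mul_div_factorial_le {θ c σ a w : ℝ} (hθ : θ ≤ c) (hc : 0 ≤ c) (hσ : 0 ≤ σ) (ha : 0 ≤ a)
    (haw : a ≤ w) (q : ℕ) : θ * σ * a ^ q / (q ! : ℝ) ≤ c * σ * w ^ q := by
  have hfact : (1 : ℝ) ≤ q ! := Nat.one_le_cast.2 q.factorial_pos
  have hw : 0 ≤ w := ha.trans haw
  calc θ * σ * a ^ q / (q ! : ℝ) ≤ c * σ * w ^ q / (q ! : ℝ) := by gcongr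
    _ ≤ c * σ * w ^ q := div_le_self (by positivity) hfact

end ModelComparison

section StepBound

section MultilinearForm

variable {E : Type*} [NormedAddCommGroup E] [NormedSpace ℝ E] {i : ℕ}

theorem neg_apply_diag_le_norm_mul_pow (A : ContinuousMultilinearMap ℝ (fun _ : Fin i => E) ℝ)
    (s : E) : -A (fun _ => s) ≤ ‖A‖ * ‖s‖ ^ i := by
  have hnorm := A.le_opNorm fun _ => s
  rw [Fin.prod_const] at hnorm
  exact (neg_le_abs _).trans hnorm

theorem neg_apply_diag_le_mul_pow {A : ContinuousMultilinearMap ℝ (fun _ : Fin i => E) ℝ} {κ : ℝ}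
    (h : ∀ d : E, ‖d‖ ≤ 1 → -κ ≤ A (fun _ => d)) (s : E) : -A (fun _ => s) ≤ κ * ‖s‖ ^ i := by
  have hs : s = ‖s‖ • (‖s‖⁻¹ • s) := by
    rcases eq_or_ne s 0 with rfl | hs
    · simp
    · rw [smul_inv_smul₀ (norm_ne_zero_iff.2 hs)]
  have hunit : ‖‖s‖⁻¹ • s‖ ≤ 1 := by
    rw [norm_smul, norm_inv, norm_norm]
    exact inv_mul_le_one
  have hhom : A (fun _ => s) = ‖s‖ ^ i * A (fun _ => ‖s‖⁻¹ • s) := by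
    conv_lhs => rw [hs]
    simpa using A.map_smul_univ (fun _ => ‖s‖) fun _ => ‖s‖⁻¹ • s
  rw [hhom]
  linarith [mul_le_mul_of_nonneg_left (h _ hunit) (pow_nonneg (norm_nonneg s) i)]

end MultilinearForm

theorem neg_one_div_factorial_mul_le (i : ℕ) {y Y : ℝ} (hY : 0 ≤ Y) (h : -y ≤ Y) :
    -(1 / (i ! : ℝ) * y) ≤ Y := by
  have hfact : (1 : ℝ) ≤ i ! := Nat.one_le_cast.2 i.factorial_pos
  rw [one_div_mul_eq_div, ← neg_div]
  exact (div_le_div_of_nonneg_right h (by positivity)).trans (div_le_self hY hfact)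

variable {n p : ℕ} {f : EuclideanSpace ℝ (Fin n) → ℝ}

theorem sub_approxTaylor_le_mul_sum_pow (hp : 1 ≤ p) {x s : EuclideanSpace ℝ (Fin n)}
    {T : ContinuousMultilinearMap ℝ (fun _ : Fin p => EuclideanSpace ℝ (Fin n)) ℝ} {A : ℝ}
    (hA : 0 ≤ A)
    (hlow : ∀ i ∈ Icc 1 (p - 1), -iteratedFDeriv ℝ i f x (fun _ => s) ≤ A * ‖s‖ ^ i)
    (htop : -T (fun _ => s) ≤ A * ‖s‖ ^ p) :
    f x - approxTaylor p f x T s ≤ A * ∑ i ∈ Icc 1 p, ‖s‖ ^ i := by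
  obtain ⟨q, rfl⟩ : ∃ q, p = q + 1 := ⟨p - 1, by lia⟩
  have hsum := sum_le_sum fun i hi =>
    neg_one_div_factorial_mul_le i (mul_nonneg hA (by positivity)) (hlow i hi)
  have hlast := neg_one_div_factorial_mul_le (q + 1) (mul_nonneg hA (by positivity)) htop
  rw [sum_neg_distrib] at hsum
  rw [sum_Icc_succ_top hp, mul_add, mul_sum, approxTaylor]
  simp only [Nat.add_sub_cancel] at hsum ⊢
  linarith

theorem neg_iteratedFDeriv_apply_diag_le (hp : 2 ≤ p) (hf : ContDiff ℝ p f)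
    {x : EuclideanSpace ℝ (Fin n)} {M : ℝ} (hM : 0 ≤ M)
    (hlow : ∀ i ∈ Icc 3 p, ∀ d : EuclideanSpace ℝ (Fin n), ‖d‖ ≤ 1 →
      -M ≤ iteratedFDeriv ℝ i f x (fun _ => d))
    (s : EuclideanSpace ℝ (Fin n)) {i : ℕ} (hi : i ∈ Icc 1 p) :
    -iteratedFDeriv ℝ i f x (fun _ => s)
      ≤ (‖gradient f x‖ + max 0 (-lambdaMin (hessianMatrix f x)) + M) * ‖s‖ ^ i := by
  have hG := norm_nonneg (gradient f x)
  have hB := le_max_left 0 (-lambdaMin (hessianMatrix f x))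
  rw [mem_Icc] at hi
  obtain rfl | rfl | hi₃ : i = 1 ∨ i = 2 ∨ 3 ≤ i := by lia
  · have hnorm := neg_apply_diag_le_norm_mul_pow (iteratedFDeriv ℝ 1 f x) s
    rw [norm_iteratedFDeriv_one, ← LinearIsometryEquiv.norm_map
      (InnerProductSpace.toDual ℝ (EuclideanSpace ℝ (Fin n))).symm] at hnorm
    exact hnorm.trans (mul_le_mul_of_nonneg_right (by rw [← gradient]; linarith) (by positivity))
  · have hcurv := lambdaMin_hessianMatrix_mul_le (hf.of_le (by exact_mod_cast hp)) x s
    calc -iteratedFDeriv ℝ 2 f x (fun _ => s)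
        ≤ -lambdaMin (hessianMatrix f x) * ‖s‖ ^ 2 := by linarith
      _ ≤ _ := by
        gcongr
        linarith [le_max_right 0 (-lambdaMin (hessianMatrix f x))]
  · refine (neg_apply_diag_le_mul_pow (hlow i (mem_Icc.2 ⟨hi₃, hi.2⟩)) s).trans ?_
    gcongr
    linarith

end StepBound

namespace IsARpLazyRun

variable {n p m : ℕ} {θ₁ θ₂ σ₀ c M : ℝ} {f : EuclideanSpace ℝ (Fin n) → ℝ}
  {x₀ : EuclideanSpace ℝ (Fin n)} {x s : ℕ → EuclideanSpace ℝ (Fin n)} {σ : ℕ → ℝ}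
  {T : ℕ → ContinuousMultilinearMap ℝ (fun _ : Fin p => EuclideanSpace ℝ (Fin n)) ℝ}

theorem tensor_eq (h : IsARpLazyRun p m θ₁ θ₂ σ₀ f x₀ x s σ T) (k : ℕ) :
    T k = iteratedFDeriv ℝ p f (x (m * (k / m))) := by
  induction k with
  | zero => simpa using h.tensor_refresh 0 (Nat.zero_mod m)
  | succ k ih =>
    by_cases hk : (k + 1) % m = 0
    · rw [h.tensor_refresh _ hk, Nat.mul_div_cancel' (Nat.dvd_of_mod_eq_zero hk)]
    · rw [h.tensor_keep k hk, ih, Nat.succ_div_of_not_dvd fun hd => hk (Nat.mod_eq_zero_of_dvd hd)]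

theorem sigma_pos (h : IsARpLazyRun p m θ₁ θ₂ σ₀ f x₀ x s σ T) (hσ₀ : 0 < σ₀) (k : ℕ) :
    0 < σ k := by
  induction k with
  | zero => rwa [h.sigma_zero]
  | succ k ih =>
    rw [h.sigma_succ]
    positivity

theorem sigma_mul_step_pow_le (h : IsARpLazyRun p m θ₁ θ₂ σ₀ f x₀ x s σ T) (hp : 1 ≤ p)
    (k : ℕ) : 1 / ((p + 1)! : ℝ) * (σ k * ‖s k‖ ^ (p + 1))
      ≤ f (x k) - approxTaylor p f (x k) (T k) (s k) := by
  have hdecrease := h.model_decrease k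
  rw [regModel, regModel, approxTaylor_zero _ _ _ hp, norm_zero, zero_pow p.succ_ne_zero,
    mul_zero] at hdecrease
  rw [one_div_mul_eq_div, mul_div_right_comm]
  linarith

theorem norm_tensor_sub_le (h : IsARpLazyRun p m θ₁ θ₂ σ₀ f x₀ x s σ T) (hm : 1 ≤ m)
    (hc : 0 ≤ c)
    (hlip : ∀ y z, ‖iteratedFDeriv ℝ p f y - iteratedFDeriv ℝ p f z‖ ≤ c * ‖y - z‖) (k : ℕ) :
    ‖T k - iteratedFDeriv ℝ p f (x k)‖ ≤ c * ∑ i ∈ Ico (k + 1 - m) k, ‖s i‖ := by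
  have hdist : ∀ i, dist (x i) (x (i + 1)) = ‖s i‖ := fun i => by
    rw [h.x_succ, dist_self_add_right]
  have hstart : k + 1 - m ≤ m * (k / m) := by
    have := Nat.div_add_mod k m
    have := Nat.mod_lt k (zero_lt_one.trans_le hm)
    lia
  rw [h.tensor_eq]
  refine (hlip _ _).trans (mul_le_mul_of_nonneg_left ?_ hc)
  calc ‖x (m * (k / m)) - x k‖ = dist (x (m * (k / m))) (x k) := (dist_eq_norm _ _).symm
    _ ≤ ∑ i ∈ Ico (m * (k / m)) k, dist (x i) (x (i + 1)) :=
        dist_le_Ico_sum_dist x (Nat.mul_div_le k m)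
    _ ≤ ∑ i ∈ Ico (k + 1 - m) k, ‖s i‖ := by
        simp only [hdist]
        exact sum_le_sum_of_subset_of_nonneg (Ico_subset_Ico_left hstart)
          fun i _ _ => norm_nonneg _

theorem norm_iteratedFDeriv_sub_le (h : IsARpLazyRun p m θ₁ θ₂ σ₀ f x₀ x s σ T) (hp : 1 ≤ p)
    (hm : 1 ≤ m) (hc : 0 ≤ c) (hf : ContDiff ℝ p f)
    (hlip : ∀ y z, ‖iteratedFDeriv ℝ p f y - iteratedFDeriv ℝ p f z‖ ≤ c * ‖y - z‖) (k : ℕ)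
    {i j : ℕ} (hij : i + j = p) :
    ‖iteratedFDeriv ℝ i f (x (k + 1)) - iteratedFDeriv ℝ i (approxTaylor p f (x k) (T k)) (s k)‖
      ≤ c * windowSum m (‖s ·‖) k ^ (j + 1) := by
  have hsymm : ∀ v (τ : Equiv.Perm (Fin p)), T k (v ∘ τ) = T k v := by
    rw [h.tensor_eq]
    exact iteratedFDeriv_comp_perm hf _
  have hw := windowSum_nonneg (fun k => norm_nonneg (s k)) m k
  rw [h.x_succ]
  calc _ ≤ (‖T k - iteratedFDeriv ℝ p f (x k)‖ + c * ‖s k‖) * ‖s k‖ ^ j :=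
        norm_iteratedFDeriv_sub_approxTaylor_le hp hc hf hlip hsymm (s k) hij
    _ ≤ (c * ∑ i ∈ Ico (k + 1 - m) k, ‖s i‖ + c * ‖s k‖) * ‖s k‖ ^ j := by
        gcongr
        exact h.norm_tensor_sub_le hm hc hlip k
    _ = c * windowSum m (‖s ·‖) k * ‖s k‖ ^ j := by
        rw [windowSum, sum_Ico_succ_top (by lia), mul_add]
    _ ≤ c * windowSum m (‖s ·‖) k * windowSum m (‖s ·‖) k ^ j := by
        gcongr
        exact le_windowSum (fun k => norm_nonneg (s k)) hm k
    _ = c * windowSum m (‖s ·‖) k ^ (j + 1) := by ring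

theorem step_bound (h : IsARpLazyRun p m θ₁ θ₂ σ₀ f x₀ x s σ T) (hp : 2 ≤ p) (hm : 1 ≤ m)
    (hc : 0 ≤ c) (hM : 0 ≤ M) (hf : ContDiff ℝ p f)
    (hlip : ∀ y z, ‖iteratedFDeriv ℝ p f y - iteratedFDeriv ℝ p f z‖ ≤ c * ‖y - z‖)
    (hlow : ∀ y, ∀ i ∈ Icc 3 p, ∀ d : EuclideanSpace ℝ (Fin n), ‖d‖ ≤ 1 →
      -M ≤ iteratedFDeriv ℝ i f y (fun _ => d)) (k : ℕ) :
    1 / ((p + 1)! : ℝ) * (σ k * ‖s k‖ ^ (p + 1)) ≤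
      (‖gradient f (x k)‖ + max 0 (-lambdaMin (hessianMatrix f (x k))) + M
        + c * ∑ i ∈ Ico (k + 1 - m) k, ‖s i‖) * ∑ i ∈ Icc 1 p, ‖s k‖ ^ i := by
  set A := ‖gradient f (x k)‖ + max 0 (-lambdaMin (hessianMatrix f (x k))) + M
  set W := c * ∑ i ∈ Ico (k + 1 - m) k, ‖s i‖
  have hA : 0 ≤ A := by positivity
  have hW : 0 ≤ W := by positivity
  have hderiv : ∀ i ∈ Icc 1 p, -iteratedFDeriv ℝ i f (x k) (fun _ => s k) ≤ A * ‖s k‖ ^ i :=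
    fun i hi => neg_iteratedFDeriv_apply_diag_le hp hf hM (hlow (x k)) (s k) hi
  have htensor : -T k (fun _ => s k) ≤ (A + W) * ‖s k‖ ^ p := by
    have hexact := hderiv p (mem_Icc.2 ⟨by lia, le_rfl⟩)
    have herror : -(T k - iteratedFDeriv ℝ p f (x k)) (fun _ => s k) ≤ W * ‖s k‖ ^ p :=
      (neg_apply_diag_le_norm_mul_pow _ _).trans
        (by gcongr; exact h.norm_tensor_sub_le hm hc hlip k)
    rw [sub_apply] at herror
    linarith
  refine (h.sigma_mul_step_pow_le (by lia) k).trans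
    (sub_approxTaylor_le_mul_sum_pow (by lia) (add_nonneg hA hW) (fun i hi => ?_) htensor)
  rw [mem_Icc] at hi
  refine (hderiv i (mem_Icc.2 ⟨hi.1, by lia⟩)).trans ?_
  gcongr
  linarith

theorem isLazyDescent (h : IsARpLazyRun p m θ₁ θ₂ σ₀ f x₀ x s σ T) (hp : 2 ≤ p) (hm : 1 ≤ m)
    (hσ₀ : 0 < σ₀) (hc : 0 < c) (hθ₁ : θ₁ ≤ c) (hθ₂ : θ₂ ≤ c) (hM : 0 ≤ M) {flow : ℝ}
    (hf : ContDiff ℝ p f) (hflow : ∀ y, flow ≤ f y)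
    (hlip : ∀ y z, ‖iteratedFDeriv ℝ p f y - iteratedFDeriv ℝ p f z‖ ≤ c * ‖y - z‖)
    (hlow : ∀ y, ∀ i ∈ Icc 3 p, ∀ d : EuclideanSpace ℝ (Fin n), ‖d‖ ≤ 1 →
      -M ≤ iteratedFDeriv ℝ i f y (fun _ => d))
    (hvalue : f x₀ - flow ≤ M) (hgrad : ‖gradient f x₀‖ ≤ M)
    (hcurv : -lambdaMin (hessianMatrix f x₀) ≤ M) :
    IsLazyDescent p m (1 / ((p + 1)! : ℝ)) c M σ₀ (fun k => ‖s k‖) σ (fun k => f (x k) - flow)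
      (fun k => ‖gradient f (x k)‖) (fun k => max 0 (-lambdaMin (hessianMatrix f (x k)))) := by
  have herror := fun k i j (hij : i + j = p) =>
    h.norm_iteratedFDeriv_sub_le (by lia) hm hc.le hf hlip k hij
  have htest := fun k θ (hθ : θ ≤ c) => mul_div_factorial_le hθ hc.le (h.sigma_pos hσ₀ k).le
    (norm_nonneg (s k)) (le_windowSum (fun k => norm_nonneg (s k)) hm k)
  refine ⟨hm, by positivity, hc, hσ₀, fun k => norm_nonneg _, fun k => sub_nonneg.2 (hflow _),
    by rwa [h.x_zero], by rwa [h.x_zero], by rw [h.x_zero]; exact max_le hM hcurv, h.sigma_zero,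
    h.sigma_succ, fun k => ?_, fun k => ?_, fun k => ?_, h.step_bound hp hm hc.le hM hf hlip hlow⟩
  · have hmodel := le_add_norm_iteratedFDeriv_zero_sub f (approxTaylor p f (x k) (T k))
      (x (k + 1)) (s k)
    linarith [herror k 0 p (zero_add p), h.sigma_mul_step_pow_le (by lia) k]
  · have hmodel := norm_gradient_le_add f (approxTaylor p f (x k) (T k)) (x (k + 1)) (s k)
    have herr := herror k 1 (p - 1) (by lia)
    rw [Nat.sub_add_cancel (by lia)] at herr
    linarith [h.gradient_test k, htest k θ₁ hθ₁ p]
  · have hmodel := lambdaMin_hessianMatrix_sub_le (hf.of_le (by exact_mod_cast hp))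
      (contDiff_approxTaylor f (x k) (T k) (by lia)) (x (k + 1)) (s k)
    have herr := herror k 2 (p - 2) (by lia)
    rw [show p - 2 + 1 = p - 1 by lia] at herr
    have htest₂ := (h.curvature_test k).trans (htest k θ₂ hθ₂ (p - 1))
    refine max_le ?_ ?_
    · linarith [(le_max_left _ _).trans htest₂, (norm_nonneg _).trans herr]
    · linarith [(le_max_right _ _).trans htest₂]

end IsARpLazyRun

theorem card_lazyEvaluations_le (p m K : ℕ) : #(lazyEvaluations p m K) ≤ p * K :=
  (card_filter_le _ _).trans (by simp)

theorem neg_max_le_iteratedFDeriv_apply_diag {E : Type*} [NormedAddCommGroup E] [NormedSpace ℝ E]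
    {f : E → ℝ} {p : ℕ} {κ κp : ℝ} {y : E}
    (hlow : ∀ i ∈ Icc 3 (p - 1), ∀ d : E, ‖d‖ ≤ 1 → -κ ≤ iteratedFDeriv ℝ i f y (fun _ => d))
    (htop : 3 ≤ p → ‖iteratedFDeriv ℝ p f y‖ ≤ κp) :
    ∀ i ∈ Icc 3 p, ∀ d : E, ‖d‖ ≤ 1 → -max κ κp ≤ iteratedFDeriv ℝ i f y (fun _ => d) := by
  intro i hi d hd
  rw [mem_Icc] at hi
  rcases hi.2.eq_or_lt with rfl | hip
  · have hnorm := neg_apply_diag_le_norm_mul_pow (iteratedFDeriv ℝ i f y) d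
    have hpow := mul_le_of_le_one_right (norm_nonneg (iteratedFDeriv ℝ i f y))
      (pow_le_one₀ (n := i) (norm_nonneg d) hd)
    linarith [htop hi.1, le_max_right κ κp]
  · linarith [hlow i (mem_Icc.2 ⟨hi.1, by lia⟩) d hd, le_max_left κ κp]

theorem mainTheorem4_general (p m : ℕ) (hp : 2 ≤ p) (hm : 1 ≤ m) (θ₁ θ₂ σ₀ : ℝ) (hσ₀ : 0 < σ₀)
    (L κ Δ G₀ B₀ : ℝ) :
    ∃ C : ℝ, 0 < C ∧
      ∀ (n : ℕ) (f : EuclideanSpace ℝ (Fin n) → ℝ) (flow : ℝ)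
        (x₀ : EuclideanSpace ℝ (Fin n)),
        ContDiff ℝ p f →
        (∀ y, flow ≤ f y) →
        (∀ y z, ‖iteratedFDeriv ℝ p f y - iteratedFDeriv ℝ p f z‖ ≤ L * ‖y - z‖) →
        (∀ y, ∀ i ∈ Icc 3 p, ∀ d : EuclideanSpace ℝ (Fin n), ‖d‖ ≤ 1 →
          -κ ≤ iteratedFDeriv ℝ i f y (fun _ => d)) →
        f x₀ - flow ≤ Δ →
        ‖gradient f x₀‖ ≤ G₀ →
        -lambdaMin (hessianMatrix f x₀) ≤ B₀ →
        ∀ (x s : ℕ → EuclideanSpace ℝ (Fin n)) (σ : ℕ → ℝ)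
          (T : ℕ → ContinuousMultilinearMap ℝ (fun _ : Fin p => EuclideanSpace ℝ (Fin n)) ℝ),
          IsARpLazyRun p m θ₁ θ₂ σ₀ f x₀ x s σ T →
          ∀ ε₁ ε₂ : ℝ, 0 < ε₁ → 0 < ε₂ →
            ∃ k : ℕ, ‖gradient f (x k)‖ ≤ ε₁ ∧ -ε₂ ≤ lambdaMin (hessianMatrix f (x k)) ∧
              (k : ℝ) ≤ C * complexityRate p ε₁ ε₂ ∧
              (#(lazyEvaluations p m k) : ℝ) ≤ C * complexityRate p ε₁ ε₂ := by
  obtain ⟨c, hc⟩ := Finset.exists_le ({1, L, θ₁, θ₂} : Finset ℝ)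
  obtain ⟨M, hM⟩ := Finset.exists_le ({0, κ, Δ, G₀, B₀} : Finset ℝ)
  simp only [mem_insert, mem_singleton, forall_eq_or_imp, forall_eq] at hc hM
  obtain ⟨hc, hLc, hθ₁, hθ₂⟩ := hc
  obtain ⟨hM, hκ, hΔM, hG₀M, hB₀M⟩ := hM
  obtain ⟨C, hC, hbound⟩ := IsLazyDescent.exists_iteration_bound p m (1 / ((p + 1)! : ℝ)) c M σ₀ hp
  refine ⟨p * C, by positivity, fun n f flow x₀ hf hflow hlip hlow hΔ hG₀ hB₀ x s σ T hrun ε₁ ε₂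
    hε₁ hε₂ => ?_⟩
  have hdescent := hrun.isLazyDescent hp hm hσ₀ (zero_lt_one.trans_le hc) hθ₁ hθ₂ hM hf hflow
    (fun y z => (hlip y z).trans (by gcongr))
    (fun y i hi d hd => (neg_le_neg hκ).trans (hlow y i hi d hd))
    (hΔ.trans hΔM) (hG₀.trans hG₀M) (hB₀.trans hB₀M)
  obtain ⟨k, hgrad, hcurv, hk⟩ := hbound hdescent ε₁ ε₂ hε₁ hε₂
  have hevals : (#(lazyEvaluations p m k) : ℝ) ≤ p * k := by
    exact_mod_cast card_lazyEvaluations_le p m k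
  have hpk : p * (k : ℝ) ≤ p * C * complexityRate p ε₁ ε₂ := by
    rw [mul_assoc]
    gcongr
  have hkp : (k : ℝ) ≤ p * k := le_mul_of_one_le_left k.cast_nonneg (by exact_mod_cast (by lia))
  exact ⟨k, hgrad, neg_le.1 ((le_max_right _ _).trans hcurv), hkp.trans hpk, hevals.trans hpk⟩

end

theorem mainTheorem4
    (p m : ℕ) (hp : 2 ≤ p) (hm : 1 ≤ m)
    (θ₁ θ₂ σ₀ : ℝ) (hθ₁ : 1 < θ₁) (hθ₂ : 1 < θ₂) (hσ₀ : 0 < σ₀)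
    (L κhigh κp : ℝ) (hL : 3 ≤ L) (hκhigh : 0 ≤ κhigh)
    (Δ G₀ B₀ : ℝ) :
    ∃ C : ℝ, 0 < C ∧
      ∀ (n : ℕ) (f : EuclideanSpace ℝ (Fin n) → ℝ) (flow : ℝ)
        (x₀ : EuclideanSpace ℝ (Fin n)),
        ContDiff ℝ p f →
        (∀ y, flow ≤ f y) →
        (∀ y z, ‖iteratedFDeriv ℝ p f y - iteratedFDeriv ℝ p f z‖ ≤ L * ‖y - z‖) →
        (∀ y, ∀ i ∈ Finset.Icc 3 (p - 1), ∀ d : EuclideanSpace ℝ (Fin n), ‖d‖ ≤ 1 →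
          -κhigh ≤ iteratedFDeriv ℝ i f y (fun _ => d)) →
        (3 ≤ p → ∀ y, ‖iteratedFDeriv ℝ p f y‖ ≤ κp) →
        f x₀ - flow ≤ Δ →
        ‖gradient f x₀‖ ≤ G₀ →
        -lambdaMin (hessianMatrix f x₀) ≤ B₀ →
        ∀ (x s : ℕ → EuclideanSpace ℝ (Fin n)) (σ : ℕ → ℝ)
          (T : ℕ → ContinuousMultilinearMap ℝ (fun _ : Fin p => EuclideanSpace ℝ (Fin n)) ℝ),
          IsARpLazyRun p m θ₁ θ₂ σ₀ f x₀ x s σ T →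
          ∀ ε₁ ε₂ : ℝ, 0 < ε₁ → 0 < ε₂ →
            ∃ k : ℕ,
              ‖gradient f (x k)‖ ≤ ε₁ ∧
              -ε₂ ≤ lambdaMin (hessianMatrix f (x k)) ∧
              (k : ℝ) ≤ C * max (ε₁ ^ (-(((p : ℝ) + 1) / p)))
                (ε₂ ^ (-(((p : ℝ) + 1) / ((p : ℝ) - 1)))) ∧
              ((lazyEvaluations p m k).card : ℝ) ≤
                C * max (ε₁ ^ (-(((p : ℝ) + 1) / p)))
                  (ε₂ ^ (-(((p : ℝ) + 1) / ((p : ℝ) - 1)))) := by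
  obtain ⟨C, hC, hbound⟩ := mainTheorem4_general p m hp hm θ₁ θ₂ σ₀ hσ₀ L (max κhigh κp) Δ G₀ B₀
  exact ⟨C, hC, fun n f flow x₀ hf hflow hlip hhigh hκp => hbound n f flow x₀ hf hflow hlip
    fun y => neg_max_le_iteratedFDeriv_apply_diag (hhigh y) (hκp · y)⟩
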